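/- Let $a,T,D\in\mathbb R$ with $a^2+D^2\neq 0$, and consider the planar linear system $$\dot x=Tx-y,\qquad \dot y=Dx-a .$$ For $y_0\ge 0$ let $\Phi(t;y_0)=(\Phi_1(t;y_0),\Phi_2(t;y_0))$ be its solution with $\Phi(0;y_0)=(0,y_0)$. The left Poincaré half-map $P$ is defined at $y_0$ by $P(y_0)=\Phi_2(\tau;y_0)\le 0$ whenever there is $\tau>0$ with $\Phi_1(\tau;y_0)=0$ and $\Phi_1(t;y_0)<0$ for all $t\in(0,\tau)$; if $P(0)$ is not defined in this way but for every $\varepsilon>0$ there are $y_0\in(0,\varepsilon)$ and $y_1\in(-\varepsilon,0)$ with $P(y_0)=y_1$, one sets $P(0)=0$. Let $I\subset[0,+\infty)$ be the set on which $P$ is so defined, and put $W(y)=Dy^2-aTy+a^2$. Assume that there is $\hat y_0>0$ in $I$ with $P(\hat y_0)=0$. Then: 1. $a<0$, $T<0$ and $4D-T^2>0$; 2. $\hat y_0$ is the left endpoint of the interval $I$; more precisely, $I=[\hat y_0,+\infty)$; 3. $P$ is injective on $I$, and the inverse function $P^{-1}:P(I)\to I$ is real analytic on $P(I)$ (including at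 the endpoint $0=P(\hat y_0)$); 4. $P$ admits a Newton–Puiseux series expansion at $\hat y_0$: there are real numbers $(c_n)_{n\ge 0}$ and $\delta>0$ with $P(y_0)=\sum_{n\ge 0}c_n(y_0-\hat y_0)^{n/2}$ (convergent series) for all $y_0\in[\hat y_0,\hat y_0+\delta)$, where $c_0=0$ and $c_1,c_2,c_3$ are the coefficients displayed below; in particular, as $y_0\to\hat y_0$ with $y_0\ge\hat y_0$, $$P(y_0)=a\sqrt{\frac{2\hat y_0}{W(\hat y_0)}}\,(y_0-\hat y_0)^{1/2}-\frac{aT}{3}\,\frac{2\hat y_0}{W(\hat y_0)}\,(y_0-\hat y_0)+\frac{a^3}{72}\left(\frac{9D+2T^2}{a^2}+\frac{9}{\hat y_0^2}\right)\left(\sqrt{\frac{2\hat y_0}{W(\hat y_0)}}\right)^{3}(y_0-\hat y_0)^{3/2}+\mathcal O\big((y_0-\hat y_0)^2\big).$$ -/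

import Mathlib

open Set Filter Topology Asymptotics

namespace PoincareHalfMap

/-- `(x, y)` is a (global) solution of the linear system in Liénard form
`x' = T x - y`, `y' = D x - a`. -/
def IsSolution (T D a : ℝ) (x y : ℝ → ℝ) : Prop :=
  ∀ t : ℝ, HasDerivAt x (T * x t - y t) t ∧ HasDerivAt y (D * x t - a) t

/-- The orbit that starts at `(0, y₀)` stays in the open half-plane `x < 0` for times in `(0, τ)`
and comes back to the line `x = 0` at `(0, y₁)`, at the time `τ > 0`. -/
def LeftReturn (T D a y₀ y₁ : ℝ) : Prop :=
  ∃ (x y : ℝ → ℝ) (τ : ℝ), IsSolution T D a x y ∧ x 0 = 0 ∧ y 0 = y₀ ∧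
    0 < τ ∧ (∀ t ∈ Ioo 0 τ, x t < 0) ∧ x τ = 0 ∧ y τ = y₁

/-- The condition under which the half-map is extended to the origin by the value `0`:
arbitrarily close to the origin there are `y₀ > 0` and `y₁ < 0` with `y₀` sent to `y₁`. -/
def ExtendsToOrigin (T D a : ℝ) : Prop :=
  ∀ ε > 0, ∃ y₀ ∈ Ioo (0 : ℝ) ε, ∃ y₁ ∈ Ioo (-ε) (0 : ℝ), LeftReturn T D a y₀ y₁

/-- The domain of definition `I ⊆ [0, +∞)` of the left Poincaré half-map. -/
def leftDomain (T D a : ℝ) : Set ℝ :=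
  {y₀ | 0 ≤ y₀ ∧ ((∃ y₁, LeftReturn T D a y₀ y₁) ∨ (y₀ = 0 ∧ ExtendsToOrigin T D a))}

open Classical in
/-- The left Poincaré half-map `P`. It is meaningful on `leftDomain T D a`, where it is the
ordinate of the first return point if there is one, and `0` at an origin added by extension. -/
noncomputable def leftHalfMap (T D a : ℝ) (y₀ : ℝ) : ℝ :=
  if h : ∃ y₁, LeftReturn T D a y₀ y₁ then h.choose else 0

/-- The polynomial `W(y) = D y² - a T y + a²`. -/
def W (T D a y : ℝ) : ℝ := D * y ^ 2 - a * T * y + a ^ 2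

end PoincareHalfMap

/-! An orbit that returns to the line at the origin forces complex eigenvalues `ω (γ ± i)` with `γ <
0` and an equilibrium in `x < 0`. With `θ = ω τ` the rotation angle at the return, both ordinates
are explicit: `startOrdinate` and `endOrdinate` are quotients by `sin θ`, and `θ` lies in `(π, 2π)`.
The derivative of each is a multiple of the other (`wronskian_expTrig`). Hence the end ordinate
increases strictly, and the start ordinate decreases strictly as long as the end ordinate is
nonpositive. If the end ordinate vanishes at `θ`, the returning orbits are those with angle in `(π,
θ]`, so `I` is a closed half-line.

The inverse `Q`, start ordinate as a function of end ordinate, is analytic because the end ordinate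
has nonzero derivative (`exists_inverse`). The first integral `W_endOrdinate` turns the derivative
formulas into `Q' Q W(y) = y W(Q)`. At `y = 0` this makes `Q` have a nondegenerate minimum, so `Q(y)
= Q(0) + s²` has an analytic solution `y = H(s)` that is nonpositive for small `s ≥ 0`. Then `P(Q(0)
+ s²) = H(s)`: this is the Puiseux series, and comparing powers of `s` in the differential equation
for `H` gives its coefficients. -/

namespace PoincareHalfMap

/-! ### Ordinates as functions of the return angle -/

/-- The auxiliary function `exp (b θ) - cos θ - b sin θ`. -/
noncomputable def expTrig (b θ : ℝ) : ℝ := Real.exp (b * θ) - Real.cos θ - b * Real.sin θ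

/-- The ordinate from which the orbit starts when it comes back to `x = 0` after the angle `θ`. -/
noncomputable def startOrdinate (γ k θ : ℝ) : ℝ := -(k * expTrig (-γ) θ / Real.sin θ)

/-- The ordinate at which the orbit comes back to `x = 0` after the angle `θ`. -/
noncomputable def endOrdinate (γ k θ : ℝ) : ℝ := k * expTrig γ θ / Real.sin θ

theorem expTrig_pos {b θ : ℝ} (hb : 0 < b) (hθ : 0 < θ) : 0 < expTrig b θ := by
  have h1 : b * θ + 1 < Real.exp (b * θ) := Real.add_one_lt_exp (mul_pos hb hθ).ne'
  have h2 := Real.cos_le_one θ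
  have h3 := mul_le_mul_of_nonneg_left (Real.sin_le hθ.le) hb.le
  unfold expTrig
  linarith

theorem expTrig_two_pi_neg {b : ℝ} (hb : b < 0) : expTrig b (2 * Real.pi) < 0 := by
  have : Real.exp (b * (2 * Real.pi)) < 1 :=
    Real.exp_lt_one_iff.2 (mul_neg_of_neg_of_pos hb (by positivity))
  simpa [expTrig] using this

theorem expTrig_neg_neg (b θ : ℝ) : expTrig (-b) (-θ) = expTrig b θ := by
  simp [expTrig]

theorem hasDerivAt_expTrig (b θ : ℝ) : HasDerivAt (expTrig b)
    (b * Real.exp (b * θ) + Real.sin θ - b * Real.cos θ) θ := by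
  have h1 : HasDerivAt (fun θ => Real.exp (b * θ)) (Real.exp (b * θ) * (b * 1)) θ :=
    ((hasDerivAt_id θ).const_mul b).exp
  have := (h1.sub (Real.hasDerivAt_cos θ)).sub ((Real.hasDerivAt_sin θ).const_mul b)
  exact this.congr_deriv (by ring)

/-- The left side is the numerator of the derivative of `expTrig b / sin`. That `expTrig (-b)`
reappears is what makes the derivatives of the two ordinates multiples of each other. -/
theorem wronskian_expTrig (b θ : ℝ) :
    (b * Real.exp (b * θ) + Real.sin θ - b * Real.cos θ) * Real.sin θ
      - expTrig b θ * Real.cos θ = Real.exp (b * θ) * expTrig (-b) θ := by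
  have h : Real.exp (b * θ) * Real.exp (-b * θ) = 1 := by rw [← Real.exp_add]; simp
  simp only [expTrig]
  linear_combination (Real.sin_sq_add_cos_sq θ) - h

theorem sin_neg_of_mem {θ : ℝ} (hθ : θ ∈ Ioo Real.pi (2 * Real.pi)) : Real.sin θ < 0 := by
  have := Real.sin_neg_of_neg_of_neg_pi_lt (x := θ - 2 * Real.pi) (by linarith [hθ.2])
    (by linarith [hθ.1])
  rwa [Real.sin_sub_two_pi] at this

theorem hasDerivAt_startOrdinate (γ k : ℝ) {θ : ℝ} (hs : Real.sin θ ≠ 0) :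
    HasDerivAt (startOrdinate γ k)
      (-(Real.exp (-γ * θ) * endOrdinate γ k θ / Real.sin θ)) θ := by
  have := ((((hasDerivAt_expTrig (-γ) θ).const_mul k).div (Real.hasDerivAt_sin θ) hs)).neg
  refine this.congr_deriv ?_
  have h := wronskian_expTrig (-γ) θ
  rw [neg_neg] at h
  unfold endOrdinate
  generalize Real.exp (-γ * θ) = E at *
  field_simp
  linear_combination -k * h

theorem hasDerivAt_endOrdinate (γ k : ℝ) {θ : ℝ} (hs : Real.sin θ ≠ 0) :
    HasDerivAt (endOrdinate γ k)
      (-(Real.exp (γ * θ) * startOrdinate γ k θ / Real.sin θ)) θ := by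
  have := ((hasDerivAt_expTrig γ θ).const_mul k).div (Real.hasDerivAt_sin θ) hs
  refine this.congr_deriv ?_
  have h := wronskian_expTrig γ θ
  unfold startOrdinate
  field_simp
  linear_combination k * h

theorem startOrdinate_pos {γ k θ : ℝ} (hγ : γ < 0) (hk : 0 < k)
    (hθ : θ ∈ Ioo Real.pi (2 * Real.pi)) : 0 < startOrdinate γ k θ := by
  have h1 := expTrig_pos (neg_pos.2 hγ) (Real.pi_pos.trans hθ.1)
  have := div_neg_of_pos_of_neg (mul_pos hk h1) (sin_neg_of_mem hθ)
  unfold startOrdinate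
  linarith

theorem endOrdinate_deriv_pos {γ k θ : ℝ} (hγ : γ < 0) (hk : 0 < k)
    (hθ : θ ∈ Ioo Real.pi (2 * Real.pi)) :
    0 < -(Real.exp (γ * θ) * startOrdinate γ k θ / Real.sin θ) :=
  neg_pos.2 (div_neg_of_pos_of_neg (mul_pos (Real.exp_pos _) (startOrdinate_pos hγ hk hθ))
    (sin_neg_of_mem hθ))

theorem strictMonoOn_endOrdinate {γ k : ℝ} (hγ : γ < 0) (hk : 0 < k) :
    StrictMonoOn (endOrdinate γ k) (Ioo Real.pi (2 * Real.pi)) := by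
  refine strictMonoOn_of_deriv_pos (convex_Ioo _ _) (fun θ hθ =>
    (hasDerivAt_endOrdinate γ k (sin_neg_of_mem hθ).ne).continuousAt.continuousWithinAt) ?_
  intro θ hθ
  rw [interior_Ioo] at hθ
  rw [(hasDerivAt_endOrdinate γ k (sin_neg_of_mem hθ).ne).deriv]
  exact endOrdinate_deriv_pos hγ hk hθ

/-- The derivative has the sign of the end ordinate, which increases and hence is negative before
`θ'`. -/
theorem strictAntiOn_startOrdinate {γ k θ' : ℝ} (hγ : γ < 0) (hk : 0 < k)
    (hθ' : θ' ∈ Ioo Real.pi (2 * Real.pi)) (hend : endOrdinate γ k θ' ≤ 0) :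
    StrictAntiOn (startOrdinate γ k) (Ioc Real.pi θ') := by
  have hsub : ∀ θ ∈ Ioc Real.pi θ', θ ∈ Ioo Real.pi (2 * Real.pi) :=
    fun θ hθ => ⟨hθ.1, hθ.2.trans_lt hθ'.2⟩
  refine strictAntiOn_of_deriv_neg (convex_Ioc _ _) (fun θ hθ =>
    (hasDerivAt_startOrdinate γ k
      (sin_neg_of_mem (hsub θ hθ)).ne).continuousAt.continuousWithinAt) ?_
  intro θ hθ
  rw [interior_Ioc] at hθ
  have hm := hsub θ (Ioo_subset_Ioc_self hθ)
  rw [(hasDerivAt_startOrdinate γ k (sin_neg_of_mem hm).ne).deriv]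
  have h1 : endOrdinate γ k θ < 0 :=
    (strictMonoOn_endOrdinate hγ hk hm hθ' hθ.2).trans_le hend
  exact neg_neg_of_pos (div_pos_of_neg_of_neg
    (mul_neg_of_pos_of_neg (Real.exp_pos _) h1) (sin_neg_of_mem hm))

/-- The first integral that relates the start and end ordinates. -/
theorem W_endOrdinate (γ ω k : ℝ) {θ : ℝ} (hs : Real.sin θ ≠ 0) :
    W (2 * γ * ω) (ω ^ 2 * (1 + γ ^ 2)) (-(k * ω * (1 + γ ^ 2))) (endOrdinate γ k θ)
      = Real.exp (γ * θ) ^ 2 *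
        W (2 * γ * ω) (ω ^ 2 * (1 + γ ^ 2)) (-(k * ω * (1 + γ ^ 2))) (startOrdinate γ k θ) := by
  have h : Real.exp (-γ * θ) = (Real.exp (γ * θ))⁻¹ := by rw [← Real.exp_neg]; ring_nf
  have he := (Real.exp_pos (γ * θ)).ne'
  have hc : Real.cos θ ^ 2 = 1 - Real.sin θ ^ 2 := by
    linarith [Real.sin_sq_add_cos_sq θ]
  simp only [W, endOrdinate, startOrdinate, expTrig, h]
  generalize Real.exp (γ * θ) = E at *
  field_simp
  ring_nf
  simp only [hc]
  ring

/-! ### Explicit solutions -/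

/-- The explicit form of a solution that passes through the line `x = 0`. -/
theorem IsSolution.eq_explicit {γ ω k : ℝ} (hω : 0 < ω) {x y : ℝ → ℝ}
    (h : IsSolution (2 * γ * ω) (ω ^ 2 * (1 + γ ^ 2)) (-(k * ω * (1 + γ ^ 2))) x y)
    {t₀ : ℝ} (h0 : x t₀ = 0) (t : ℝ) :
    x (t₀ + t) = -(Real.exp (γ * (ω * t)) / ω) *
      (k * expTrig (-γ) (ω * t) + y t₀ * Real.sin (ω * t)) ∧
    y (t₀ + t) = γ * ω * x (t₀ + t) - γ * k + Real.exp (γ * (ω * t)) *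
      (k * Real.sin (ω * t) + (y t₀ + γ * k) * Real.cos (ω * t)) := by
  have hω' := hω.ne'
  -- Coordinates centred at the equilibrium, where the field is `γ ω` times the identity plus a
  -- rotation of speed `ω`. Undoing both yields the two constants of motion `h1` and `h2`.
  set p : ℝ → ℝ := fun s => x (t₀ + s) + k / ω with hp
  set q : ℝ → ℝ := fun s => (γ * ω * x (t₀ + s) - y (t₀ + s) - γ * k) / ω with hq
  have hx : ∀ s, HasDerivAt (fun s => x (t₀ + s)) (2 * γ * ω * x (t₀ + s) - y (t₀ + s)) s :=
    fun s => (h (t₀ + s)).1.comp_const_add t₀ s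
  have hy : ∀ s, HasDerivAt (fun s => y (t₀ + s))
      (ω ^ 2 * (1 + γ ^ 2) * x (t₀ + s) - (-(k * ω * (1 + γ ^ 2)))) s :=
    fun s => (h (t₀ + s)).2.comp_const_add t₀ s
  have hp' : ∀ s, HasDerivAt p (γ * ω * p s + ω * q s) s := fun s =>
    ((hx s).add_const (k / ω)).congr_deriv (by simp only [hp, hq]; field_simp; ring)
  have hq' : ∀ s, HasDerivAt q (γ * ω * q s - ω * p s) s := fun s =>
    (((((hx s).const_mul (γ * ω)).sub (hy s)).sub_const (γ * k)).div_const ω).congr_deriv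
      (by simp only [hp, hq]; field_simp; ring)
  have hlin : ∀ s, HasDerivAt (fun s => ω * s) ω s := fun s => by
    simpa using (hasDerivAt_id s).const_mul ω
  have he : ∀ s, HasDerivAt (fun s => Real.exp (-γ * (ω * s)))
      (Real.exp (-γ * (ω * s)) * (-γ * ω)) s := fun s => ((hlin s).const_mul (-γ)).exp
  have hc : ∀ s, HasDerivAt (fun s => Real.cos (ω * s)) (-Real.sin (ω * s) * ω) s :=
    fun s => (hlin s).cos
  have hs : ∀ s, HasDerivAt (fun s => Real.sin (ω * s)) (Real.cos (ω * s) * ω) s :=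
    fun s => (hlin s).sin
  have h1 : ∀ s, HasDerivAt (fun s => Real.exp (-γ * (ω * s)) *
      (p s * Real.cos (ω * s) - q s * Real.sin (ω * s))) 0 s := fun s =>
    ((he s).mul (((hp' s).mul (hc s)).sub ((hq' s).mul (hs s)))).congr_deriv (by
      simp only [Pi.mul_apply, Pi.sub_apply]; ring)
  have h2 : ∀ s, HasDerivAt (fun s => Real.exp (-γ * (ω * s)) *
      (p s * Real.sin (ω * s) + q s * Real.cos (ω * s))) 0 s := fun s =>
    ((he s).mul (((hp' s).mul (hs s)).add ((hq' s).mul (hc s)))).congr_deriv (by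
      simp only [Pi.mul_apply, Pi.add_apply]; ring)
  have k1 := is_const_of_deriv_eq_zero (fun s => (h1 s).differentiableAt)
    (fun s => (h1 s).deriv) t 0
  have k2 := is_const_of_deriv_eq_zero (fun s => (h2 s).differentiableAt)
    (fun s => (h2 s).deriv) t 0
  have hE : Real.exp (-γ * (ω * t)) = (Real.exp (γ * (ω * t)))⁻¹ := by
    rw [← Real.exp_neg]; ring_nf
  simp only [mul_zero, Real.exp_zero, Real.cos_zero, Real.sin_zero, hE] at k1 k2
  have hp0 : p 0 = k / ω := by simp [hp, h0]
  have hq0 : q 0 = -(y t₀ + γ * k) / ω := by simp [hq, h0]; ring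
  simp only [hp0, hq0] at k1 k2
  have hE0 := (Real.exp_pos (γ * (ω * t))).ne'
  have hcs := Real.sin_sq_add_cos_sq (ω * t)
  have hxt : x (t₀ + t) = p t - k / ω := by simp [hp]
  have hyt : y (t₀ + t) = γ * ω * x (t₀ + t) - γ * k - ω * q t := by
    simp only [hq]; field_simp; ring
  simp only [expTrig, hE]
  generalize Real.exp (γ * (ω * t)) = E at *
  generalize Real.cos (ω * t) = C at *
  generalize Real.sin (ω * t) = S at *
  have e1 : p t * C - q t * S = E * (k / ω) := by
    field_simp at k1 ⊢
    linear_combination k1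
  have e2 : p t * S + q t * C = E * (-(y t₀ + γ * k) / ω) := by
    field_simp at k2 ⊢
    linear_combination k2
  have e3 : p t = E * (k / ω) * C + E * (-(y t₀ + γ * k) / ω) * S := by
    linear_combination C * e1 + S * e2 - p t * hcs
  have e4 : q t = -(E * (k / ω)) * S + E * (-(y t₀ + γ * k) / ω) * C := by
    linear_combination -S * e1 + C * e2 - q t * hcs
  refine ⟨?_, ?_⟩
  · rw [hxt, e3]; field_simp; ring
  · rw [hyt, e4]; field_simp; ring

/-- Existence of solutions starting on the line `x = 0`. -/
theorem exists_isSolution {γ ω : ℝ} (hω : 0 < ω) (k y₀ : ℝ) : ∃ x y : ℝ → ℝ,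
    IsSolution (2 * γ * ω) (ω ^ 2 * (1 + γ ^ 2)) (-(k * ω * (1 + γ ^ 2))) x y ∧
      x 0 = 0 ∧ y 0 = y₀ := by
  have hω' := hω.ne'
  have hlin : ∀ s, HasDerivAt (fun s => ω * s) ω s := fun s => by
    simpa using (hasDerivAt_id s).const_mul ω
  have he : ∀ s, HasDerivAt (fun s => Real.exp (γ * (ω * s)))
      (Real.exp (γ * (ω * s)) * (γ * ω)) s := fun s => ((hlin s).const_mul γ).exp
  have hc : ∀ s, HasDerivAt (fun s => Real.cos (ω * s)) (-Real.sin (ω * s) * ω) s :=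
    fun s => (hlin s).cos
  have hs : ∀ s, HasDerivAt (fun s => Real.sin (ω * s)) (Real.cos (ω * s) * ω) s :=
    fun s => (hlin s).sin
  set p : ℝ → ℝ := fun s => Real.exp (γ * (ω * s)) *
    (k / ω * Real.cos (ω * s) - (y₀ + γ * k) / ω * Real.sin (ω * s)) with hp
  set q : ℝ → ℝ := fun s => Real.exp (γ * (ω * s)) *
    (-(k / ω) * Real.sin (ω * s) - (y₀ + γ * k) / ω * Real.cos (ω * s)) with hq
  have hp' : ∀ s, HasDerivAt p (γ * ω * p s + ω * q s) s := fun s =>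
    ((he s).mul (((hc s).const_mul (k / ω)).sub ((hs s).const_mul ((y₀ + γ * k) / ω)))).congr_deriv
      (by simp only [hp, hq, Pi.sub_apply]; ring)
  have hq' : ∀ s, HasDerivAt q (γ * ω * q s - ω * p s) s := fun s =>
    ((he s).mul (((hs s).const_mul (-(k / ω))).sub
      ((hc s).const_mul ((y₀ + γ * k) / ω)))).congr_deriv
      (by simp only [hp, hq, Pi.sub_apply]; ring)
  refine ⟨fun t => p t - k / ω, fun t => γ * ω * (p t - k / ω) - γ * k - ω * q t,
    fun t => ⟨((hp' t).sub_const _).congr_deriv ?_,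
      (((((hp' t).sub_const (k / ω)).const_mul (γ * ω)).sub_const (γ * k)).sub
        ((hq' t).const_mul ω)).congr_deriv ?_⟩, ?_, ?_⟩
  · field_simp; ring
  · field_simp; ring
  · simp [hp]
  · simp [hp, hq]; field_simp; ring

/-! ### Return angles and the domain of the half-map -/

theorem eventually_pos_left_of_hasDerivAt_neg {f : ℝ → ℝ} {c τ : ℝ} (hf : HasDerivAt f c τ)
    (hc : c < 0) (h0 : f τ = 0) : ∀ᶠ t in 𝓝[<] τ, 0 < f t := by
  have h := (hasDerivAt_iff_tendsto_slope.1 hf).mono_left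
    (nhdsWithin_mono τ (fun t (ht : t < τ) => ht.ne))
  filter_upwards [h.eventually_lt_const hc, self_mem_nhdsWithin] with t ht htτ
  rw [slope_def_field, h0, sub_zero] at ht
  have : t - τ < 0 := sub_neg.2 htτ
  by_contra hneg
  exact absurd (div_nonneg_of_nonpos (not_lt.1 hneg) this.le) (not_le.2 ht)

/-- On the line `x' = -y`, so a positive end ordinate would put the orbit in `x > 0` just before the
return. -/
theorem LeftReturn.end_nonpos {T D a y₀ y₁ : ℝ} (h : LeftReturn T D a y₀ y₁) : y₁ ≤ 0 := by
  obtain ⟨x, y, τ, hsol, -, -, hτ, hneg, hxτ, rfl⟩ := h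
  by_contra hpos
  have hd := (hsol τ).1
  rw [hxτ, mul_zero, zero_sub] at hd
  have h1 := eventually_pos_left_of_hasDerivAt_neg hd (by linarith) hxτ
  obtain ⟨t, ht, ht'⟩ := (h1.and (Ioo_mem_nhdsLT hτ)).exists
  exact lt_asymm ht (hneg t ht')

theorem LeftReturn.exists_angle {γ ω k y₀ y₁ : ℝ} (hω : 0 < ω) (hγ : γ < 0) (hk : 0 < k)
    (hy₀ : 0 ≤ y₀)
    (h : LeftReturn (2 * γ * ω) (ω ^ 2 * (1 + γ ^ 2)) (-(k * ω * (1 + γ ^ 2))) y₀ y₁) :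
    ∃ θ ∈ Ioo Real.pi (2 * Real.pi), startOrdinate γ k θ = y₀ ∧ endOrdinate γ k θ = y₁ := by
  obtain ⟨x, y, τ, hsol, hx0, rfl, hτ, hneg, hxτ, rfl⟩ := h
  have hformula := hsol.eq_explicit hω hx0 τ
  rw [zero_add, hxτ] at hformula
  obtain ⟨h1, h2⟩ := hformula
  have hθ : 0 < ω * τ := mul_pos hω hτ
  have hn := mul_pos hk (expTrig_pos (neg_pos.2 hγ) hθ)
  have hE := Real.exp_pos (γ * (ω * τ))
  have h3 : k * expTrig (-γ) (ω * τ) + y 0 * Real.sin (ω * τ) = 0 := by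
    rcases mul_eq_zero.1 h1.symm with h | h
    · exact absurd h (neg_ne_zero.2 (div_pos hE hω).ne')
    · exact h
  -- Up to angle `π` both terms of `h3` are nonnegative and the first is positive.
  have hpi : Real.pi < ω * τ := by
    by_contra hle
    have := mul_nonneg hy₀ (Real.sin_nonneg_of_nonneg_of_le_pi hθ.le (not_lt.1 hle))
    linarith
  -- One full turn backwards from the end point the orbit has `x > 0`; after an angle of at least
  -- `2π` that moment would fall within the left excursion.
  have h2pi : ω * τ < 2 * Real.pi := by
    by_contra hle
    have hs : ω * (-(2 * Real.pi / ω)) = -(2 * Real.pi) := by field_simp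
    have hb := (hsol.eq_explicit hω hxτ (-(2 * Real.pi / ω))).1
    rw [hs, expTrig_neg_neg, Real.sin_neg, Real.sin_two_pi] at hb
    have hle' : 2 * Real.pi / ω ≤ τ := by
      rw [div_le_iff₀ hω]; linarith
    have hxle : x (τ + -(2 * Real.pi / ω)) ≤ 0 := by
      rcases hle'.eq_or_lt with he | hl
      · rw [he, add_neg_cancel, hx0]
      · have : 0 < 2 * Real.pi / ω := by positivity
        exact (hneg _ ⟨by linarith, by linarith⟩).le
    have hk2 := mul_neg_of_pos_of_neg hk (expTrig_two_pi_neg hγ)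
    rw [hb] at hxle
    have := mul_pos_of_neg_of_neg
      (neg_neg_of_pos (div_pos (Real.exp_pos (γ * (-(2 * Real.pi)))) hω)) hk2
    linarith
  have hmem : ω * τ ∈ Ioo Real.pi (2 * Real.pi) := ⟨hpi, h2pi⟩
  have hsin := (sin_neg_of_mem hmem).ne
  have hstart : startOrdinate γ k (ω * τ) = y 0 := by
    unfold startOrdinate
    field_simp
    linarith
  refine ⟨ω * τ, hmem, hstart, ?_⟩
  rw [h2]
  have hexp : Real.exp (γ * (ω * τ)) * Real.exp (-γ * (ω * τ)) = 1 := by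
    rw [← Real.exp_add]; simp
  simp only [expTrig] at h3
  simp only [endOrdinate, expTrig]
  have hcs := Real.sin_sq_add_cos_sq (ω * τ)
  generalize Real.exp (γ * (ω * τ)) = E at *
  generalize Real.exp (-γ * (ω * τ)) = E' at *
  field_simp
  linear_combination (-E * Real.cos (ω * τ)) * h3 - E * k * hcs + k * Real.cos (ω * τ) * hexp

theorem leftReturn_ordinates {γ ω k θ : ℝ} (hω : 0 < ω) (hγ : γ < 0) (hk : 0 < k)
    (hθ : θ ∈ Ioo Real.pi (2 * Real.pi)) (hend : endOrdinate γ k θ ≤ 0) :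
    LeftReturn (2 * γ * ω) (ω ^ 2 * (1 + γ ^ 2)) (-(k * ω * (1 + γ ^ 2)))
      (startOrdinate γ k θ) (endOrdinate γ k θ) := by
  obtain ⟨x, y, hsol, hx0, hy0⟩ := exists_isSolution (γ := γ) hω k (startOrdinate γ k θ)
  have hstart := startOrdinate_pos hγ hk hθ
  have hx : ∀ t, x t = -(Real.exp (γ * (ω * t)) / ω) *
      (k * expTrig (-γ) (ω * t) + startOrdinate γ k θ * Real.sin (ω * t)) := fun t => by
    simpa [hy0] using (hsol.eq_explicit hω hx0 t).1
  have hτ : 0 < θ / ω := div_pos (Real.pi_pos.trans hθ.1) hω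
  have hmul : ω * (θ / ω) = θ := by field_simp
  have hneg : ∀ t ∈ Ioo 0 (θ / ω), x t < 0 := by
    intro t ht
    rw [hx]
    refine mul_neg_of_neg_of_pos (neg_neg_of_pos (div_pos (Real.exp_pos _) hω)) ?_
    have h0 : 0 < ω * t := mul_pos hω ht.1
    have hlt : ω * t < θ := by
      have := mul_lt_mul_of_pos_left ht.2 hω
      rwa [hmul] at this
    have hn := mul_pos hk (expTrig_pos (neg_pos.2 hγ) h0)
    rcases le_or_gt (ω * t) Real.pi with hle | hgt
    · have := mul_nonneg hstart.le (Real.sin_nonneg_of_nonneg_of_le_pi h0.le hle)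
      linarith
    -- Beyond `π`, negativity of `x` at this angle amounts to its start ordinate exceeding that of
    -- `θ`, which is the monotonicity.
    · have hs := sin_neg_of_mem (θ := ω * t) ⟨hgt, hlt.trans hθ.2⟩
      have hanti := strictAntiOn_startOrdinate hγ hk hθ hend ⟨hgt, hlt.le⟩ ⟨hθ.1, le_rfl⟩ hlt
      have h1 := mul_lt_mul_of_neg_right hanti hs
      have h2 : startOrdinate γ k (ω * t) * Real.sin (ω * t) = -(k * expTrig (-γ) (ω * t)) := by
        unfold startOrdinate
        field_simp [hs.ne]
      linarith
  have hxτ : x (θ / ω) = 0 := by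
    rw [hx, hmul]
    have hs := (sin_neg_of_mem hθ).ne
    have : startOrdinate γ k θ * Real.sin θ = -(k * expTrig (-γ) θ) := by
      unfold startOrdinate
      field_simp
    rw [this]; ring
  have hret : LeftReturn (2 * γ * ω) (ω ^ 2 * (1 + γ ^ 2)) (-(k * ω * (1 + γ ^ 2)))
      (startOrdinate γ k θ) (y (θ / ω)) :=
    ⟨x, y, θ / ω, hsol, hx0, hy0, hτ, hneg, hxτ, rfl⟩
  -- The end ordinate is identified without computing `y`: the return has some angle `φ` with the
  -- same start ordinate, and injectivity up to the larger of `φ` and `θ` forces `φ = θ`.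
  obtain ⟨φ, hφ, hφ0, hφ1⟩ := hret.exists_angle hω hγ hk hstart.le
  have hφend : endOrdinate γ k φ ≤ 0 := hφ1.trans_le hret.end_nonpos
  have hinj : φ = θ := by
    rcases le_total φ θ with hle | hle
    · exact (strictAntiOn_startOrdinate hγ hk hθ hend).injOn ⟨hφ.1, hle⟩ ⟨hθ.1, le_rfl⟩ hφ0
    · exact (strictAntiOn_startOrdinate hγ hk hφ hφend).injOn ⟨hφ.1, le_rfl⟩ ⟨hθ.1, hle⟩ hφ0
  rw [← hφ1, hinj] at hret
  exact hret

theorem leftHalfMap_startOrdinate {γ ω k θ : ℝ} (hω : 0 < ω) (hγ : γ < 0) (hk : 0 < k)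
    (hθ : θ ∈ Ioo Real.pi (2 * Real.pi)) (hend : endOrdinate γ k θ ≤ 0) :
    leftHalfMap (2 * γ * ω) (ω ^ 2 * (1 + γ ^ 2)) (-(k * ω * (1 + γ ^ 2)))
      (startOrdinate γ k θ) = endOrdinate γ k θ := by
  have hex : ∃ y₁, LeftReturn (2 * γ * ω) (ω ^ 2 * (1 + γ ^ 2)) (-(k * ω * (1 + γ ^ 2)))
    (startOrdinate γ k θ) y₁ := ⟨_, leftReturn_ordinates hω hγ hk hθ hend⟩
  rw [leftHalfMap, dif_pos hex]
  have hret := hex.choose_spec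
  obtain ⟨φ, hφ, hφ0, hφ1⟩ := hret.exists_angle hω hγ hk (startOrdinate_pos hγ hk hθ).le
  have hφend : endOrdinate γ k φ ≤ 0 := hφ1.trans_le hret.end_nonpos
  have hinj : φ = θ := by
    rcases le_total φ θ with hle | hle
    · exact (strictAntiOn_startOrdinate hγ hk hθ hend).injOn ⟨hφ.1, hle⟩ ⟨hθ.1, le_rfl⟩ hφ0
    · exact (strictAntiOn_startOrdinate hγ hk hφ hφend).injOn ⟨hφ.1, le_rfl⟩ ⟨hθ.1, hle⟩ hφ0
  rw [← hφ1, hinj]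

/-- Every ordinate above that of the orbit tangent at the origin is a start ordinate. -/
theorem exists_startOrdinate_eq {γ k θ y₀ : ℝ} (hγ : γ < 0) (hk : 0 < k)
    (hθ : θ ∈ Ioo Real.pi (2 * Real.pi)) (hy₀ : startOrdinate γ k θ ≤ y₀) :
    ∃ φ ∈ Ioc Real.pi θ, startOrdinate γ k φ = y₀ := by
  -- The equation is multiplied by `sin φ`, since the start ordinate itself blows up at `π`.
  have hcont : ContinuousOn (fun φ => y₀ * Real.sin φ + k * expTrig (-γ) φ) (Icc Real.pi θ) := by
    unfold expTrig; fun_prop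
  have hs := sin_neg_of_mem hθ
  have hright : y₀ * Real.sin θ + k * expTrig (-γ) θ ≤ 0 := by
    have h1 := mul_le_mul_of_nonpos_right hy₀ hs.le
    have h2 : startOrdinate γ k θ * Real.sin θ = -(k * expTrig (-γ) θ) := by
      unfold startOrdinate
      field_simp [hs.ne]
    linarith
  have hleft : 0 < y₀ * Real.sin Real.pi + k * expTrig (-γ) Real.pi := by
    have := mul_pos hk (expTrig_pos (neg_pos.2 hγ) Real.pi_pos)
    simpa using this
  obtain ⟨φ, hφ, hφ0⟩ := intermediate_value_Icc' hθ.1.le hcont ⟨hright, hleft.le⟩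
  have hne : Real.pi ≠ φ := by
    rintro rfl
    exact hleft.ne' hφ0
  have hφ' : φ ∈ Ioc Real.pi θ := ⟨lt_of_le_of_ne hφ.1 hne, hφ.2⟩
  have hsφ := (sin_neg_of_mem ⟨hφ'.1, hφ'.2.trans_lt hθ.2⟩).ne
  refine ⟨φ, hφ', ?_⟩
  simp only at hφ0
  unfold startOrdinate
  field_simp
  linarith

theorem leftDomain_eq_Ici {γ ω k θ : ℝ} (hω : 0 < ω) (hγ : γ < 0) (hk : 0 < k)
    (hθ : θ ∈ Ioo Real.pi (2 * Real.pi)) (hend : endOrdinate γ k θ = 0) :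
    leftDomain (2 * γ * ω) (ω ^ 2 * (1 + γ ^ 2)) (-(k * ω * (1 + γ ^ 2)))
      = Ici (startOrdinate γ k θ) := by
  have hpos := startOrdinate_pos hγ hk hθ
  have key : ∀ y₀ y₁, 0 ≤ y₀ → LeftReturn (2 * γ * ω) (ω ^ 2 * (1 + γ ^ 2))
      (-(k * ω * (1 + γ ^ 2))) y₀ y₁ → startOrdinate γ k θ ≤ y₀ := by
    intro y₀ y₁ hy₀ h
    obtain ⟨φ, hφ, rfl, hφ1⟩ := h.exists_angle hω hγ hk hy₀
    have hle : endOrdinate γ k φ ≤ endOrdinate γ k θ := by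
      rw [hφ1, hend]; exact h.end_nonpos
    have hle' : φ ≤ θ := ((strictMonoOn_endOrdinate hγ hk).le_iff_le hφ hθ).1 hle
    exact (strictAntiOn_startOrdinate hγ hk hθ hend.le).antitoneOn ⟨hφ.1, hle'⟩
      ⟨hθ.1, le_rfl⟩ hle'
  ext y₀
  constructor
  · rintro ⟨hy₀, ⟨y₁, h⟩ | ⟨rfl, hext⟩⟩
    · exact key y₀ y₁ hy₀ h
    -- Start ordinates are bounded below by a positive number, so the origin is not added by
    -- extension.
    · obtain ⟨y₀, hy₀, y₁, -, h⟩ := hext _ hpos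
      exact absurd (key y₀ y₁ hy₀.1.le h) (not_le.2 hy₀.2)
  · intro hy₀
    obtain ⟨φ, hφ, rfl⟩ := exists_startOrdinate_eq hγ hk hθ hy₀
    have hφ' : φ ∈ Ioo Real.pi (2 * Real.pi) := ⟨hφ.1, hφ.2.trans_lt hθ.2⟩
    refine ⟨(startOrdinate_pos hγ hk hφ').le, Or.inl ⟨_, leftReturn_ordinates hω hγ hk hφ' ?_⟩⟩
    rw [← hend]
    exact (strictMonoOn_endOrdinate hγ hk).monotoneOn hφ' hθ hφ.2

/-! ### The analytic inverse and its differential equation -/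

theorem analyticAt_expTrig (b θ : ℝ) : AnalyticAt ℝ (expTrig b) θ := by
  unfold expTrig
  exact (((analyticAt_const.mul analyticAt_id).rexp').sub Real.analyticAt_cos).sub
    (analyticAt_const.mul Real.analyticAt_sin)

/-- An analytic inverse of the half-map, defined in a neighbourhood of the end ordinates, together
with the differential equation that it satisfies. -/
theorem exists_inverse (ω : ℝ) {γ k : ℝ} (hγ : γ < 0) (hk : 0 < k) :
    ∃ Q : ℝ → ℝ, ∀ θ ∈ Ioo Real.pi (2 * Real.pi),
      Q (endOrdinate γ k θ) = startOrdinate γ k θ ∧ AnalyticAt ℝ Q (endOrdinate γ k θ) ∧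
      (∀ᶠ y in 𝓝 (endOrdinate γ k θ), ∃ φ ∈ Ioo Real.pi (2 * Real.pi), endOrdinate γ k φ = y) ∧
      deriv Q (endOrdinate γ k θ) * (startOrdinate γ k θ *
          W (2 * γ * ω) (ω ^ 2 * (1 + γ ^ 2)) (-(k * ω * (1 + γ ^ 2))) (endOrdinate γ k θ)) =
        endOrdinate γ k θ *
          W (2 * γ * ω) (ω ^ 2 * (1 + γ ^ 2)) (-(k * ω * (1 + γ ^ 2))) (startOrdinate γ k θ) := by
  have hinj := (strictMonoOn_endOrdinate hγ hk).injOn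
  refine ⟨fun y => startOrdinate γ k
    (Function.invFunOn (endOrdinate γ k) (Ioo Real.pi (2 * Real.pi)) y), fun θ hθ => ?_⟩
  set Q : ℝ → ℝ := fun y => startOrdinate γ k
    (Function.invFunOn (endOrdinate γ k) (Ioo Real.pi (2 * Real.pi)) y) with hQ
  have hQe : ∀ φ ∈ Ioo Real.pi (2 * Real.pi), Q (endOrdinate γ k φ) = startOrdinate γ k φ :=
    fun φ hφ => by simp only [hQ, hinj.leftInvOn_invFunOn hφ]
  have hs := (sin_neg_of_mem hθ).ne
  have hIoo : Ioo Real.pi (2 * Real.pi) ∈ 𝓝 θ := Ioo_mem_nhds hθ.1 hθ.2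
  have hd1 := hasDerivAt_endOrdinate γ k hs
  have hd0 := hasDerivAt_startOrdinate γ k hs
  have hpos := endOrdinate_deriv_pos hγ hk hθ
  have hd1' : deriv (endOrdinate γ k) θ ≠ 0 := by rw [hd1.deriv]; exact hpos.ne'
  have han1 : AnalyticAt ℝ (endOrdinate γ k) θ :=
    (analyticAt_const.mul (analyticAt_expTrig γ θ)).div Real.analyticAt_sin hs
  have han0 : AnalyticAt ℝ (startOrdinate γ k) θ :=
    ((analyticAt_const.mul (analyticAt_expTrig (-γ) θ)).div Real.analyticAt_sin hs).neg
  have heq : Q ∘ endOrdinate γ k =ᶠ[𝓝 θ] startOrdinate γ k := by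
    filter_upwards [hIoo] with φ hφ using hQe φ hφ
  -- Analyticity of `Q` follows from that of `Q ∘ endOrdinate`, because the inner function has
  -- nonzero derivative.
  have hanQ : AnalyticAt ℝ Q (endOrdinate γ k θ) :=
    (analyticAt_comp_iff_of_deriv_ne_zero han1 hd1').1 (han0.congr heq.symm)
  refine ⟨hQe θ hθ, hanQ, ?_, ?_⟩
  · rw [← han1.hasStrictDerivAt.map_nhds_eq hd1']
    exact mem_map.2 (mem_of_superset hIoo fun φ hφ => ⟨φ, hφ, rfl⟩)
  · have hcomp := (hanQ.differentiableAt.hasDerivAt.comp θ hd1).congr_of_eventuallyEq heq.symm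
    have hu := hcomp.unique hd0
    -- The chain rule gives `Q' = exp (-2γθ) * end / start`; the first integral removes the
    -- exponential.
    rw [W_endOrdinate γ ω k hs]
    have hE : Real.exp (-γ * θ) * Real.exp (γ * θ) = 1 := by rw [← Real.exp_add]; simp
    have h1 : deriv Q (endOrdinate γ k θ) * (Real.exp (γ * θ) * startOrdinate γ k θ) =
        Real.exp (-γ * θ) * endOrdinate γ k θ := by
      generalize Real.exp (-γ * θ) = E' at *
      field_simp at hu
      linarith
    linear_combination Real.exp (γ * θ) * W (2 * γ * ω) (ω ^ 2 * (1 + γ ^ 2))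
      (-(k * ω * (1 + γ ^ 2))) (startOrdinate γ k θ) * h1 + endOrdinate γ k θ *
      W (2 * γ * ω) (ω ^ 2 * (1 + γ ^ 2)) (-(k * ω * (1 + γ ^ 2))) (startOrdinate γ k θ) * hE

/-! ### Square-root inversion and the Puiseux coefficients -/

theorem eventually_eq_zero_of_mul {F : ℝ → ℝ} (hF : ContinuousAt F 0)
    (h : ∀ᶠ s in 𝓝 0, s * F s = 0) : ∀ᶠ s in 𝓝 0, F s = 0 := by
  have h1 : F =ᶠ[𝓝[≠] 0] fun _ => (0 : ℝ) := by
    filter_upwards [h.filter_mono nhdsWithin_le_nhds, self_mem_nhdsWithin] with s hs hne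
    exact (mul_eq_zero.1 hs).resolve_left hne
  exact (hF.eventuallyEq_nhds_iff_eventuallyEq_nhdsNE continuousAt_const).1 h1

theorem coeffs_eq_zero_of_eventually {e₁ e₂ e₃ : ℝ} {K : ℝ → ℝ} (hK : ContinuousAt K 0)
    (h : ∀ᶠ s in 𝓝 0, e₁ * s + e₂ * s ^ 2 + e₃ * s ^ 3 + s ^ 4 * K s = 0) :
    e₁ = 0 ∧ e₂ = 0 ∧ e₃ = 0 := by
  have h1 := eventually_eq_zero_of_mul (F := fun s => e₁ + s * (e₂ + s * (e₃ + s * K s)))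
    (by fun_prop) (by filter_upwards [h] with s hs; linear_combination hs)
  obtain rfl : e₁ = 0 := by simpa using h1.self_of_nhds
  have h2 := eventually_eq_zero_of_mul (F := fun s => e₂ + s * (e₃ + s * K s))
    (by fun_prop) (by simpa using h1)
  obtain rfl : e₂ = 0 := by simpa using h2.self_of_nhds
  have h3 := eventually_eq_zero_of_mul (F := fun s => e₃ + s * K s)
    (by fun_prop) (by simpa using h2)
  exact ⟨rfl, rfl, by simpa using h3.self_of_nhds⟩

/-- Taylor expansion to order three with an analytic remainder. -/
theorem exists_remainder {H : ℝ → ℝ} {p : FormalMultilinearSeries ℝ ℝ ℝ}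
    (hp : HasFPowerSeriesAt H p 0) (h0 : H 0 = 0) : ∃ R : ℝ → ℝ, AnalyticAt ℝ R 0 ∧
      ∀ s, H s = p.coeff 1 * s + p.coeff 2 * s ^ 2 + p.coeff 3 * s ^ 3 + s ^ 4 * R s := by
  have hstep : ∀ n s, (Function.swap dslope 0)^[n] H s =
      p.coeff n + s * (Function.swap dslope 0)^[n + 1] H s := by
    intro n s
    have hn := (hp.has_fpower_series_iterate_dslope_fslope n).coeff_zero 1
    rw [← FormalMultilinearSeries.coeff, FormalMultilinearSeries.coeff_iterate_fslope,
      zero_add] at hn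
    have hs := sub_smul_dslope ((Function.swap dslope 0)^[n] H) 0 s
    rw [sub_zero, smul_eq_mul, ← hn] at hs
    rw [Function.iterate_succ_apply']
    change _ = _ + s * dslope _ 0 s
    linarith
  refine ⟨_, (hp.has_fpower_series_iterate_dslope_fslope 4).analyticAt, fun s => ?_⟩
  have hc0 : p.coeff 0 = 0 := by
    have := hstep 0 0
    simpa [h0] using this.symm
  have h1 := hstep 0 s
  rw [Function.iterate_zero, id, hc0] at h1
  rw [h1, hstep 1, hstep 2, hstep 3]
  ring

/-- Local analytic solution of `Q y = Q 0 + s ^ 2`, decreasing in `s`, at a nondegenerate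
minimum of `Q`. -/
theorem exists_analytic_sqrt_inverse {Q h : ℝ → ℝ} (hQ : AnalyticAt ℝ Q 0)
    (hh : ContinuousAt h 0) (hpos : 0 < h 0) (hder : ∀ᶠ y in 𝓝 0, deriv Q y = y * h y) :
    ∃ H : ℝ → ℝ, AnalyticAt ℝ H 0 ∧ H 0 = 0 ∧ deriv H 0 < 0 ∧
      (∀ᶠ s in 𝓝 0, Q (H s) = Q 0 + s ^ 2) ∧ ∀ᶠ s in 𝓝 0, 0 ≤ s → H s ≤ 0 := by
  obtain ⟨pQ, hpQ⟩ := hQ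
  have hQ0 : deriv Q 0 = 0 := by simpa using hder.self_of_nhds
  set g : ℝ → ℝ := dslope (dslope Q 0) 0 with hg
  have hgan : AnalyticAt ℝ g 0 :=
    (hpQ.has_fpower_series_dslope_fslope.has_fpower_series_dslope_fslope).analyticAt
  have hQg : ∀ y, Q y = Q 0 + y ^ 2 * g y := by
    intro y
    have h1 := sub_smul_dslope Q 0 y
    have h2 := sub_smul_dslope (dslope Q 0) 0 y
    rw [dslope_same, hQ0, sub_zero, sub_zero, smul_eq_mul, ← hg] at h2
    rw [sub_zero, smul_eq_mul, ← h2] at h1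
    linarith
  -- Differentiating `Q = Q 0 + y² g` and cancelling `y` gives `2 g + y g' = h`, hence `g 0 = h 0 /
  -- 2`.
  have hgpos : 0 < g 0 := by
    have hgc : ContinuousAt (deriv g) 0 := hgan.deriv.continuousAt
    have hgc' : ContinuousAt g 0 := hgan.continuousAt
    have hev := eventually_eq_zero_of_mul (F := fun y => 2 * g y + y * deriv g y - h y)
      (by fun_prop) (by
        filter_upwards [hder, hgan.eventually_analyticAt] with y hy hgy
        have hd : HasDerivAt (fun y => Q 0 + y ^ 2 * g y) (2 * y * g y + y ^ 2 * deriv g y) y := by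
          have := (((hasDerivAt_id y).pow 2).mul hgy.differentiableAt.hasDerivAt).const_add (Q 0)
          exact this.congr_deriv (by simp)
        rw [← funext hQg] at hd
        rw [hd.deriv] at hy
        linear_combination hy)
    have := hev.self_of_nhds
    simp only [zero_mul, add_zero] at this
    linarith
  have hsqrt : AnalyticAt ℝ (fun y => √(g y)) 0 :=
    (Real.contDiffAt_sqrt (n := ⊤) hgpos.ne').analyticAt.comp hgan
  -- Since `σ² = Q - Q 0`, its local inverse is the required `H`; the minus sign selects the branch
  -- with nonpositive values for `s ≥ 0`.
  set σ : ℝ → ℝ := fun y => -(y * √(g y)) with hσ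
  have hσan : AnalyticAt ℝ σ 0 := (analyticAt_id.mul hsqrt).neg
  have hσ0 : σ 0 = 0 := by simp [hσ]
  have hσd : deriv σ 0 = -√(g 0) := by
    have : HasDerivAt σ (-√(g 0)) 0 :=
      ((hasDerivAt_id (0 : ℝ)).mul hsqrt.differentiableAt.hasDerivAt).neg.congr_deriv (by simp)
    exact this.deriv
  have hr : 0 < √(g 0) := Real.sqrt_pos.2 hgpos
  have hne : deriv σ 0 ≠ 0 := by rw [hσd]; exact (neg_neg_of_pos hr).ne
  set H := hσan.hasStrictDerivAt.localInverse _ _ _ hne with hH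
  have hHan : AnalyticAt ℝ H 0 := by
    have := hσan.analyticAt_localInverse hne
    rwa [hσ0] at this
  have hright : ∀ᶠ s in 𝓝 0, σ (H s) = s := by
    have := HasStrictDerivAt.eventually_right_inverse hσan.hasStrictDerivAt hne
    rwa [hσ0] at this
  have hH0 : H 0 = 0 := by
    have := (HasStrictDerivAt.eventually_left_inverse hσan.hasStrictDerivAt hne).self_of_nhds
    rwa [hσ0] at this
  have hHd : deriv H 0 < 0 := by
    have := (HasStrictDerivAt.to_localInverse hσan.hasStrictDerivAt hne).hasDerivAt.deriv
    rw [hσ0] at this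
    rw [hH, this, hσd]
    exact inv_lt_zero.2 (neg_neg_of_pos hr)
  have hgH : ∀ᶠ s in 𝓝 0, 0 < g (H s) := by
    have hc : ContinuousAt (fun s => g (H s)) 0 :=
      ContinuousAt.comp (by rw [hH0]; exact hgan.continuousAt) hHan.continuousAt
    exact hc.eventually_const_lt (show 0 < g (H 0) by rwa [hH0])
  refine ⟨H, hHan, hH0, hHd, ?_, ?_⟩
  · filter_upwards [hright, hgH] with s hs hgs
    rw [hQg]
    have : (√(g (H s))) ^ 2 = g (H s) := Real.sq_sqrt hgs.le
    simp only [hσ] at hs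
    rw [← this]
    conv_rhs => rw [← hs]
    ring
  · filter_upwards [hright, hgH] with s hs hgs hs0
    by_contra hneg
    have := mul_pos (not_le.1 hneg) (Real.sqrt_pos.2 hgs)
    simp only [hσ] at hs
    linarith

theorem coeff_relations {T D a yhat c₁ c₂ c₃ : ℝ} {H R : ℝ → ℝ} (hR : AnalyticAt ℝ R 0)
    (hH : ∀ s, H s = c₁ * s + c₂ * s ^ 2 + c₃ * s ^ 3 + s ^ 4 * R s)
    (hode : ∀ᶠ s in 𝓝 0, H s * deriv H s * W T D a (yhat + s ^ 2) =
      2 * s * (yhat + s ^ 2) * W T D a (H s)) :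
    c₁ ^ 2 * W T D a yhat = 2 * yhat * a ^ 2 ∧
    3 * c₁ * c₂ * W T D a yhat = -(2 * yhat * a * T * c₁) ∧
    (4 * c₁ * c₃ + 2 * c₂ ^ 2) * W T D a yhat + c₁ ^ 2 * (2 * D * yhat - a * T) =
      2 * yhat * (D * c₁ ^ 2 - a * T * c₂) + 2 * a ^ 2 := by
  set M : ℝ → ℝ := fun s => 4 * R s + s * deriv R s with hM
  have hRc : ContinuousAt R 0 := hR.continuousAt
  have hRd : ContinuousAt (deriv R) 0 := hR.deriv.continuousAt
  have hMc : ContinuousAt M 0 := by fun_prop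
  have hder : ∀ᶠ s in 𝓝 0, deriv H s = c₁ + 2 * c₂ * s + 3 * c₃ * s ^ 2 + s ^ 3 * M s := by
    filter_upwards [hR.eventually_analyticAt] with s hs
    have h1 := hasDerivAt_id s
    have := (((h1.const_mul c₁).add ((h1.pow 2).const_mul c₂)).add
      ((h1.pow 3).const_mul c₃)).add ((h1.pow 4).mul hs.differentiableAt.hasDerivAt)
    have h2 : HasDerivAt H (c₁ + 2 * c₂ * s + 3 * c₃ * s ^ 2 + s ^ 3 * M s) s := by
      rw [funext hH]
      refine this.congr_deriv ?_
      simp only [hM, id, Pi.pow_apply]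
      push_cast
      ring
    exact h2.deriv
  -- Remainders: `P` collects the terms of `H * H'` from order 4 on, `V` those of `W(H)` from order
  -- 3 on, and `K` those of the difference of both sides from order 4 on.
  set P : ℝ → ℝ := fun s => c₁ * M s + 5 * c₂ * c₃ + R s * c₁
    + s * (c₂ * M s + 3 * c₃ ^ 2 + 2 * c₂ * R s) + s ^ 2 * (c₃ * M s + 3 * c₃ * R s)
    + s ^ 3 * (R s * M s) with hP
  set h2 : ℝ → ℝ := fun s => c₃ + s * R s with hh2
  set V : ℝ → ℝ := fun s => -(a * T * h2 s) + D * (2 * c₁ * c₂ + s * (c₂ ^ 2 + 2 * c₁ * h2 s)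
    + 2 * c₂ * h2 s * s ^ 2 + s ^ 3 * h2 s ^ 2) with hV
  have hPc : ContinuousAt P 0 := by fun_prop
  have hh2c : ContinuousAt h2 0 := by fun_prop
  have hVc : ContinuousAt V 0 := by fun_prop
  set K : ℝ → ℝ := fun s => P s * (W T D a yhat + (2 * D * yhat - a * T) * s ^ 2 + D * s ^ 4)
    + (2 * D * yhat - a * T + D * s ^ 2) * (3 * c₁ * c₂ + (4 * c₁ * c₃ + 2 * c₂ ^ 2) * s)
    + D * s * c₁ ^ 2
    - (2 * yhat * V s - 2 * a * T * c₁ + 2 * s * (D * c₁ ^ 2 - a * T * c₂) + 2 * s ^ 2 * V s)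
    with hK
  have hKc : ContinuousAt K 0 := by fun_prop
  obtain ⟨h1, h2, h3⟩ := coeffs_eq_zero_of_eventually
    (e₁ := c₁ ^ 2 * W T D a yhat - 2 * yhat * a ^ 2)
    (e₂ := 3 * c₁ * c₂ * W T D a yhat + 2 * yhat * a * T * c₁)
    (e₃ := (4 * c₁ * c₃ + 2 * c₂ ^ 2) * W T D a yhat + c₁ ^ 2 * (2 * D * yhat - a * T) -
      (2 * yhat * (D * c₁ ^ 2 - a * T * c₂) + 2 * a ^ 2)) hKc (by
      filter_upwards [hode, hder] with s hs hd
      rw [hd, hH] at hs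
      simp only [W] at hs ⊢
      simp only [hK, hP, hV, hh2, W]
      generalize M s = m at *
      linear_combination hs)
  exact ⟨by linarith, by linarith, by linarith⟩

theorem coeffs_eq {T D a yhat c₁ c₂ c₃ : ℝ} (ha : a < 0) (hy : 0 < yhat)
    (hW : 0 < W T D a yhat) (hc₁ : c₁ < 0)
    (h1 : c₁ ^ 2 * W T D a yhat = 2 * yhat * a ^ 2)
    (h2 : 3 * c₁ * c₂ * W T D a yhat = -(2 * yhat * a * T * c₁))
    (h3 : (4 * c₁ * c₃ + 2 * c₂ ^ 2) * W T D a yhat + c₁ ^ 2 * (2 * D * yhat - a * T) =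
      2 * yhat * (D * c₁ ^ 2 - a * T * c₂) + 2 * a ^ 2) :
    c₁ = a * √(2 * yhat / W T D a yhat) ∧
    c₂ = -(a * T / 3) * (2 * yhat / W T D a yhat) ∧
    c₃ = a ^ 3 / 72 * ((9 * D + 2 * T ^ 2) / a ^ 2 + 9 / yhat ^ 2) *
        √(2 * yhat / W T D a yhat) ^ 3 := by
  have hw : W T D a yhat = D * yhat ^ 2 - a * T * yhat + a ^ 2 := rfl
  have hrpos : 0 < √(2 * yhat / W T D a yhat) := Real.sqrt_pos.2 (by positivity)
  have hr2 : √(2 * yhat / W T D a yhat) ^ 2 = 2 * yhat / W T D a yhat :=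
    Real.sq_sqrt (by positivity)
  generalize √(2 * yhat / W T D a yhat) = r at *
  generalize W T D a yhat = w at *
  have hr : r ^ 2 * w = 2 * yhat := by rw [hr2]; field_simp
  rw [← hr2]
  -- The first relation fixes only the square; `c₁ < 0` and `a < 0` settle the sign.
  obtain rfl : c₁ = a * r := by
    have hsq : (-c₁) ^ 2 = (-(a * r)) ^ 2 :=
      mul_right_cancel₀ hW.ne' (by linear_combination h1 - a ^ 2 * hr)
    have hneg : a * r < 0 := mul_neg_of_neg_of_pos ha hrpos
    have := (pow_left_inj₀ (by linarith) (by linarith) two_ne_zero).1 hsq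
    linarith
  obtain rfl : c₂ = -(a * T / 3) * r ^ 2 := by
    have hne : 3 * (a * r) * w ≠ 0 := mul_ne_zero (mul_ne_zero three_ne_zero hc₁.ne) hW.ne'
    exact mul_left_cancel₀ hne (by linear_combination h2 + a * r * a * T * hr)
  refine ⟨rfl, rfl, ?_⟩
  -- The third relation after inserting `c₁` and `c₂`. In `i2`, trading `r² w` for `2 yhat` and
  -- expanding `w` cancels the terms linear in `T`.
  have i1 : 36 * r * c₃ * w = a * (2 * yhat * T ^ 2 * r ^ 2 + 18 + 9 * a * T * r ^ 2) :=
    mul_left_cancel₀ ha.ne (by linear_combination 9 * h3 - 2 * a ^ 2 * T ^ 2 * r ^ 2 * hr)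
  have i2 : 72 * c₃ * yhat ^ 2 = a * r ^ 3 * ((9 * D + 2 * T ^ 2) * yhat ^ 2 + 9 * a ^ 2) := by
    linear_combination r * yhat * i1 - 36 * c₃ * yhat * hr - 9 * a * r * hr
      + 9 * a * r ^ 3 * hw
  have ha' := ha.ne
  field_simp
  linear_combination i2

/-- The Puiseux parametrization of the inverse of `Q` at a zero of its derivative, for a solution
`Q` of the differential equation of the inverse half-map. -/
theorem exists_puiseux {T D a yhat : ℝ} {Q : ℝ → ℝ} (ha : a < 0) (hy : 0 < yhat)
    (hW : 0 < W T D a yhat) (hQ : AnalyticAt ℝ Q 0) (hQ0 : Q 0 = yhat)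
    (hode : ∀ᶠ y in 𝓝 0, deriv Q y * (Q y * W T D a y) = y * W T D a (Q y)) :
    ∃ (H R : ℝ → ℝ) (p : FormalMultilinearSeries ℝ ℝ ℝ), HasFPowerSeriesAt H p 0 ∧
      ContinuousAt R 0 ∧ H 0 = 0 ∧ (∀ᶠ s in 𝓝 0, Q (H s) = yhat + s ^ 2) ∧
      (∀ᶠ s in 𝓝 0, 0 ≤ s → H s ≤ 0) ∧
      (∀ s, H s = p.coeff 1 * s + p.coeff 2 * s ^ 2 + p.coeff 3 * s ^ 3 + s ^ 4 * R s) ∧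
      p.coeff 1 = a * √(2 * yhat / W T D a yhat) ∧
      p.coeff 2 = -(a * T / 3) * (2 * yhat / W T D a yhat) ∧
      p.coeff 3 = a ^ 3 / 72 * ((9 * D + 2 * T ^ 2) / a ^ 2 + 9 / yhat ^ 2) *
        √(2 * yhat / W T D a yhat) ^ 3 := by
  have hW0 : W T D a 0 = a ^ 2 := by simp [W]
  have hWc : Continuous (W T D a) := by unfold W; fun_prop
  have hQc := hQ.continuousAt
  have hden : ContinuousAt (fun y => Q y * W T D a y) 0 := hQc.mul hWc.continuousAt
  have hdenpos : 0 < Q 0 * W T D a 0 := by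
    rw [hQ0, hW0]; exact mul_pos hy (sq_pos_of_neg ha)
  obtain ⟨H, ⟨p, hp⟩, hH0, hHd, hQH, hHneg⟩ := exists_analytic_sqrt_inverse
    (h := fun y => W T D a (Q y) / (Q y * W T D a y)) hQ
    ((hWc.continuousAt.comp hQc).div hden hdenpos.ne')
    (div_pos (by rwa [hQ0]) hdenpos) (by
      filter_upwards [hode, hden.eventually_const_lt hdenpos] with y hy hpos
      rw [← mul_div_assoc, eq_div_iff hpos.ne', hy])
  rw [hQ0] at hQH
  obtain ⟨R, hR, hHR⟩ := exists_remainder hp hH0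
  have hHan : AnalyticAt ℝ H 0 := ⟨p, hp⟩
  have hHc : Tendsto H (𝓝 0) (𝓝 0) := by
    have := hHan.continuousAt.tendsto
    rwa [hH0] at this
  have hodeH : ∀ᶠ s in 𝓝 0, H s * deriv H s * W T D a (yhat + s ^ 2) =
      2 * s * (yhat + s ^ 2) * W T D a (H s) := by
    -- Differentiating `Q (H s) = yhat + s²` gives `Q'(H) H' = 2 s`, which eliminates `Q` from the
    -- differential equation.
    filter_upwards [hHc.eventually hode, hHc.eventually hQ.eventually_analyticAt,
      hHan.eventually_analyticAt, eventually_eventually_nhds.2 hQH] with s h1 h2 h3 h4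
    have hcomp := h2.differentiableAt.hasDerivAt.comp s h3.differentiableAt.hasDerivAt
    have hsq : HasDerivAt (fun s : ℝ => yhat + s ^ 2) (2 * s) s := by
      simpa using (hasDerivAt_pow 2 s).const_add yhat
    have hu := (hcomp.congr_of_eventuallyEq (EventuallyEq.symm h4)).unique hsq
    rw [h4.self_of_nhds] at h1
    linear_combination (yhat + s ^ 2) * W T D a (H s) * hu - deriv H s * h1
  obtain ⟨e1, e2, e3⟩ := coeff_relations hR hHR hodeH
  have hd1 : p.coeff 1 < 0 := by
    have := hp.deriv
    rwa [this] at hHd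
  exact ⟨H, R, p, hp, hR.continuousAt, hH0, hQH, hHneg, hHR,
    coeffs_eq ha hy hW hd1 e1 e2 e3⟩

/-! ### Sign conditions forced by a return at the origin -/

/-- An orbit that comes back at the origin forces `a ≤ 0`. -/
theorem LeftReturn.a_nonpos {T D a y₀ : ℝ} (h : LeftReturn T D a y₀ 0) : a ≤ 0 := by
  obtain ⟨x, y, τ, hsol, -, -, hτ, hneg, hxτ, hyτ⟩ := h
  by_contra hpos
  have hv : HasDerivAt (fun t => y t - T * x t) (-a) τ := by
    refine ((hsol τ).2.sub ((hsol τ).1.const_mul T)).congr_deriv ?_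
    rw [hxτ, hyτ]; ring
  have h1 := eventually_pos_left_of_hasDerivAt_neg hv (by linarith) (by simp [hxτ, hyτ])
  obtain ⟨s, hs, hs'⟩ := mem_nhdsLT_iff_exists_Ioo_subset.1 (inter_mem h1 (Ioo_mem_nhdsLT hτ))
  obtain ⟨r, hr1, hr2⟩ := exists_between (show s < τ from hs)
  have hanti : StrictAntiOn x (Icc r τ) := by
    refine strictAntiOn_of_deriv_neg (convex_Icc _ _)
      (fun t _ => (hsol t).1.continuousAt.continuousWithinAt) fun t ht => ?_
    rw [interior_Icc] at ht
    rw [(hsol t).1.deriv]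
    have : 0 < y t - T * x t := (hs' ⟨hr1.trans ht.1, ht.2⟩).1
    linarith
  have := hanti ⟨le_rfl, hr2.le⟩ ⟨hr2.le, le_rfl⟩ hr2
  rw [hxτ] at this
  exact lt_asymm this (hneg r (hs' ⟨hr1, hr2⟩).2)

/-- An orbit that comes back at the origin cannot exist with real eigenvalues. -/
theorem LeftReturn.discriminant_pos {T D a y₀ : ℝ} (h : LeftReturn T D a y₀ 0) :
    0 < 4 * D - T ^ 2 := by
  have ha := h.a_nonpos
  obtain ⟨x, y, τ, hsol, hx0, -, hτ, hneg, hxτ, hyτ⟩ := h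
  by_contra hdisc
  obtain ⟨l, m, hT, hD⟩ : ∃ l m : ℝ, T = l + m ∧ D = l * m := by
    have hs : √(T ^ 2 - 4 * D) ^ 2 = T ^ 2 - 4 * D := Real.sq_sqrt (by linarith)
    exact ⟨(T + √(T ^ 2 - 4 * D)) / 2, (T - √(T ^ 2 - 4 * D)) / 2, by ring,
      by linear_combination hs / 4⟩
  have hexp : ∀ c t : ℝ, HasDerivAt (fun t => Real.exp (-c * t)) (Real.exp (-c * t) * -c) t :=
    fun c t => by simpa using ((hasDerivAt_id t).const_mul (-c)).exp
  -- With `v = x'` and real eigenvalues `l`, `m`, the function `w = v' - l v` satisfies `w' = m w`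
  -- and equals `a ≤ 0` at `τ`. So `w ≤ 0` throughout, and `exp (-l t) v` decreases to zero at `τ`;
  -- then `x` is nondecreasing from `0`, against `x < 0`.
  set v : ℝ → ℝ := fun t => T * x t - y t with hv
  set w : ℝ → ℝ := fun t => m * v t - D * x t + a with hw
  have hv' : ∀ t, HasDerivAt v (w t + l * v t) t := fun t =>
    (((hsol t).1.const_mul T).sub (hsol t).2).congr_deriv (by simp only [hw, hv, hT]; ring)
  have hw' : ∀ t, HasDerivAt w (m * w t) t := fun t =>
    ((((hv' t).const_mul m).sub ((hsol t).1.const_mul D)).add_const a).congr_deriv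
      (by simp only [hw, hv, hT, hD]; ring)
  have hexpw : ∀ t, HasDerivAt (fun t => Real.exp (-m * t) * w t) 0 t := fun t =>
    ((hexp m t).mul (hw' t)).congr_deriv (by ring)
  have hexpv : ∀ t, HasDerivAt (fun t => Real.exp (-l * t) * v t) (Real.exp (-l * t) * w t) t :=
    fun t => ((hexp l t).mul (hv' t)).congr_deriv (by ring)
  have hconst : ∀ t, Real.exp (-m * t) * w t = Real.exp (-m * τ) * w τ := fun t =>
    is_const_of_deriv_eq_zero (fun t => (hexpw t).differentiableAt) (fun t => (hexpw t).deriv) t τ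
  have hwτ : w τ = a := by simp [hw, hv, hxτ, hyτ]
  have hwneg : ∀ t, w t ≤ 0 := fun t => by
    have h1 : Real.exp (-m * t) * w t ≤ 0 := by
      rw [hconst, hwτ]
      exact mul_nonpos_of_nonneg_of_nonpos (Real.exp_pos _).le ha
    exact nonpos_of_mul_nonpos_right h1 (Real.exp_pos _)
  have hanti : Antitone (fun t => Real.exp (-l * t) * v t) := by
    refine antitone_of_deriv_nonpos (fun t => (hexpv t).differentiableAt) fun t => ?_
    rw [(hexpv t).deriv]
    exact mul_nonpos_of_nonneg_of_nonpos (Real.exp_pos _).le (hwneg t)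
  have hvnonneg : ∀ t ≤ τ, 0 ≤ v t := fun t ht => by
    have h1 := hanti ht
    have hvτ : v τ = 0 := by simp [hv, hxτ, hyτ]
    simp only [hvτ, mul_zero] at h1
    exact nonneg_of_mul_nonneg_right h1 (Real.exp_pos _)
  have hmono : MonotoneOn x (Icc 0 τ) := by
    refine monotoneOn_of_deriv_nonneg (convex_Icc _ _)
      (fun t _ => (hsol t).1.continuousAt.continuousWithinAt)
      (fun t _ => (hsol t).1.differentiableAt.differentiableWithinAt) fun t ht => ?_
    rw [interior_Icc] at ht
    rw [(hsol t).1.deriv]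
    exact hvnonneg t ht.2.le
  have h1 := hmono (left_mem_Icc.2 hτ.le) (show τ / 2 ∈ Icc 0 τ from ⟨by linarith, by linarith⟩)
    (by linarith)
  have h2 := hneg (τ / 2) ⟨by linarith, by linarith⟩
  linarith

/-- Following the orbit backwards from the origin, `x` is a multiple of `k * expTrig γ`. For `k = 0`
it vanishes identically; for `γ > 0` it never comes back to the line; for `γ = 0` it does so only
after full turns, at the origin, against `y₀ > 0`. -/
theorem LeftReturn.focus_params {γ ω k y₀ : ℝ} (hω : 0 < ω) (hk : 0 ≤ k) (hy₀ : 0 < y₀)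
    (h : LeftReturn (2 * γ * ω) (ω ^ 2 * (1 + γ ^ 2)) (-(k * ω * (1 + γ ^ 2))) y₀ 0) :
    0 < k ∧ γ < 0 := by
  obtain ⟨x, y, τ, hsol, hx0, rfl, hτ, hneg, hxτ, hyτ⟩ := h
  have hb : ∀ s, x (τ + -s) = -(Real.exp (γ * (ω * -s)) / ω) * (k * expTrig γ (ω * s)) ∧
      y (τ + -s) = γ * ω * x (τ + -s) - γ * k + Real.exp (γ * (ω * -s)) *
      (-(k * Real.sin (ω * s)) + γ * k * Real.cos (ω * s)) := fun s => by
    have := hsol.eq_explicit hω hxτ (-s)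
    rw [hyτ, mul_neg ω s, expTrig_neg_neg, Real.sin_neg, Real.cos_neg] at this
    rw [mul_neg ω s]
    exact ⟨this.1.trans (by ring), this.2.trans (by ring)⟩
  have hk' : 0 < k := by
    refine hk.lt_of_ne' ?_
    rintro rfl
    have h1 := (hb (τ / 2)).1
    have h2 := hneg (τ + -(τ / 2)) ⟨by linarith, by linarith⟩
    rw [h1] at h2
    simp at h2
  refine ⟨hk', ?_⟩
  by_contra hγ
  obtain ⟨h1, h2⟩ := hb τ
  rw [add_neg_cancel, hx0] at h1 h2
  have hE := Real.exp_pos (γ * (ω * -τ))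
  have h3 : expTrig γ (ω * τ) = 0 := by
    rcases mul_eq_zero.1 h1.symm with h | h
    · exact absurd h (neg_ne_zero.2 (div_pos hE hω).ne')
    · exact (mul_eq_zero.1 h).resolve_left hk'.ne'
  rcases (not_lt.1 hγ).eq_or_lt with rfl | hγ'
  · have hcos : Real.cos (ω * τ) = 1 := by
      simp only [expTrig, zero_mul, Real.exp_zero, sub_zero] at h3
      linarith
    have hsin : Real.sin (ω * τ) = 0 := by
      have := Real.sin_sq_add_cos_sq (ω * τ)
      rw [hcos] at this
      exact pow_eq_zero_iff two_ne_zero |>.1 (by linarith)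
    rw [hsin, hcos] at h2
    simp at h2
    exact hy₀.ne' h2
  · exact (expTrig_pos hγ' (mul_pos hω hτ)).ne' h3

/-- The eigenvalues are `T / 2 ± i ω`, which fixes `ω` and `γ = T / (2 ω)`; the equilibrium has
abscissa `-k / ω`. -/
theorem exists_focus_params {T D a : ℝ} (hdisc : 0 < 4 * D - T ^ 2) (ha : a ≤ 0) :
    ∃ γ ω k : ℝ, 0 < ω ∧ 0 ≤ k ∧ T = 2 * γ * ω ∧ D = ω ^ 2 * (1 + γ ^ 2) ∧
      a = -(k * ω * (1 + γ ^ 2)) := by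
  set ω := √(4 * D - T ^ 2) / 2 with hωdef
  have hω : 0 < ω := half_pos (Real.sqrt_pos.2 hdisc)
  have hω2 : 4 * ω ^ 2 = 4 * D - T ^ 2 := by
    rw [hωdef, div_pow, Real.sq_sqrt hdisc.le]; ring
  have hpos : 0 < 1 + (T / (2 * ω)) ^ 2 := by positivity
  refine ⟨T / (2 * ω), ω, -a / (ω * (1 + (T / (2 * ω)) ^ 2)), hω,
    div_nonneg (by linarith) (mul_pos hω hpos).le, by field_simp, ?_, ?_⟩
  · field_simp; linarith
  · generalize T / (2 * ω) = g at *
    field_simp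

theorem W_pos {γ ω k : ℝ} (hω : 0 < ω) (hk : 0 < k) (y : ℝ) :
    0 < W (2 * γ * ω) (ω ^ 2 * (1 + γ ^ 2)) (-(k * ω * (1 + γ ^ 2))) y := by
  have h : W (2 * γ * ω) (ω ^ 2 * (1 + γ ^ 2)) (-(k * ω * (1 + γ ^ 2))) y =
      ω ^ 2 * (1 + γ ^ 2) * ((y + γ * k) ^ 2 + k ^ 2) := by
    unfold W; ring
  rw [h]
  positivity

end PoincareHalfMap

/-! ### Assembly of the theorem -/

open PoincareHalfMap in
theorem proposition3 (T D a : ℝ) (haD : a ^ 2 + D ^ 2 ≠ 0) (yhat : ℝ) (hpos : 0 < yhat)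
    (hmem : yhat ∈ PoincareHalfMap.leftDomain T D a)
    (hzero : PoincareHalfMap.leftHalfMap T D a yhat = 0) :
    a < 0 ∧ T < 0 ∧ 0 < 4 * D - T ^ 2 ∧
    -- `yhat` is the left endpoint of `I`, and `I` is the whole half-line
    PoincareHalfMap.leftDomain T D a = Set.Ici yhat ∧
    -- the inverse function exists on `P(I)` and is real analytic there, endpoint included
    (∃ Q : ℝ → ℝ,
      Set.LeftInvOn Q (PoincareHalfMap.leftHalfMap T D a) (PoincareHalfMap.leftDomain T D a) ∧
      AnalyticOn ℝ Q
        (PoincareHalfMap.leftHalfMap T D a '' PoincareHalfMap.leftDomain T D a)) ∧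
    -- convergent Newton–Puiseux series with the given first coefficients
    (∃ c : ℕ → ℝ,
      c 0 = 0 ∧
      c 1 = a * √(2 * yhat / PoincareHalfMap.W T D a yhat) ∧
      c 2 = -(a * T / 3) * (2 * yhat / PoincareHalfMap.W T D a yhat) ∧
      c 3 = a ^ 3 / 72 * ((9 * D + 2 * T ^ 2) / a ^ 2 + 9 / yhat ^ 2) *
        √(2 * yhat / PoincareHalfMap.W T D a yhat) ^ 3 ∧
      ∃ δ > 0, ∀ y ∈ Set.Ico yhat (yhat + δ),
        HasSum (fun n : ℕ => c n * (y - yhat) ^ ((n : ℝ) / 2))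
          (PoincareHalfMap.leftHalfMap T D a y)) ∧
    -- the expansion up to order `3/2`
    (fun y : ℝ => PoincareHalfMap.leftHalfMap T D a y -
        (a * √(2 * yhat / PoincareHalfMap.W T D a yhat) * (y - yhat) ^ (1 / 2 : ℝ)
          - a * T / 3 * (2 * yhat / PoincareHalfMap.W T D a yhat) * (y - yhat)
          + a ^ 3 / 72 * ((9 * D + 2 * T ^ 2) / a ^ 2 + 9 / yhat ^ 2) *
            √(2 * yhat / PoincareHalfMap.W T D a yhat) ^ 3 * (y - yhat) ^ (3 / 2 : ℝ)))
      =O[𝓝[≥] yhat] (fun y : ℝ => (y - yhat) ^ 2) := by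
  have hret : LeftReturn T D a yhat 0 := by
    rcases hmem.2 with hex | ⟨h0, -⟩
    · rw [leftHalfMap, dif_pos hex] at hzero
      have := hex.choose_spec
      rwa [hzero] at this
    · exact absurd h0 hpos.ne'
  have hdisc := hret.discriminant_pos
  obtain ⟨γ, ω, k, hω, hk, rfl, rfl, rfl⟩ := exists_focus_params hdisc hret.a_nonpos
  obtain ⟨hk, hγ⟩ := hret.focus_params hω hk hpos
  have ha : -(k * ω * (1 + γ ^ 2)) < 0 := neg_neg_of_pos (by positivity)
  obtain ⟨θ, hθ, rfl, hend⟩ := hret.exists_angle hω hγ hk hpos.le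
  have hdom := leftDomain_eq_Ici hω hγ hk hθ hend
  obtain ⟨Q, hQ⟩ := exists_inverse ω hγ hk
  have hmono := strictMonoOn_endOrdinate hγ hk
  have hval : ∀ y ∈ leftDomain (2 * γ * ω) (ω ^ 2 * (1 + γ ^ 2)) (-(k * ω * (1 + γ ^ 2))),
      ∃ φ ∈ Ioo Real.pi (2 * Real.pi), startOrdinate γ k φ = y ∧
        leftHalfMap (2 * γ * ω) (ω ^ 2 * (1 + γ ^ 2)) (-(k * ω * (1 + γ ^ 2))) y =
          endOrdinate γ k φ := by
    intro y hy
    rw [hdom] at hy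
    obtain ⟨φ, hφ, rfl⟩ := exists_startOrdinate_eq hγ hk hθ hy
    have hφ' : φ ∈ Ioo Real.pi (2 * Real.pi) := ⟨hφ.1, hφ.2.trans_lt hθ.2⟩
    refine ⟨φ, hφ', rfl, leftHalfMap_startOrdinate hω hγ hk hφ' ?_⟩
    rw [← hend]
    exact hmono.monotoneOn hφ' hθ hφ.2
  -- Angles slightly beyond `θ` give positive end ordinates, so `Q` is controlled on both sides of
  -- `0`, although `P` takes only nonpositive values.
  obtain ⟨hQθ, hQan, hQnear, -⟩ := hQ θ hθ
  rw [hend] at hQθ hQan hQnear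
  obtain ⟨H, R, p, hp, hR, hH0, hQH, hHneg, hHR, hc1, hc2, hc3⟩ :=
    exists_puiseux ha hpos (W_pos hω hk _) hQan hQθ (by
      filter_upwards [hQnear] with y hy
      obtain ⟨φ, hφ, rfl⟩ := hy
      obtain ⟨h1, -, -, h2⟩ := hQ φ hφ
      rwa [h1])
  set P := leftHalfMap (2 * γ * ω) (ω ^ 2 * (1 + γ ^ 2)) (-(k * ω * (1 + γ ^ 2))) with hP
  set yhat := startOrdinate γ k θ with hyhat
  have hHc : Tendsto H (𝓝 0) (𝓝 0) := by
    have := hp.continuousAt.tendsto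
    rwa [hH0] at this
  -- For `s ≥ 0` the value `H s ≤ 0` is the end ordinate of an actual return, whose start ordinate
  -- is `Q (H s) = yhat + s²`.
  have hPH : ∀ᶠ s in 𝓝 (0 : ℝ), 0 ≤ s → P (yhat + s ^ 2) = H s := by
    filter_upwards [hHc.eventually hQnear, hQH, hHneg] with s ⟨φ, hφ, hφH⟩ h2 h3 hs
    have h4 := (hQ φ hφ).1
    rw [hφH, h2] at h4
    rw [h4, ← hφH]
    exact leftHalfMap_startOrdinate hω hγ hk hφ (hφH.trans_le (h3 hs))
  have hsqrtc : Tendsto (fun y => √(y - yhat)) (𝓝[≥] yhat) (𝓝 0) := by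
    have hc : Continuous fun y => √(y - yhat) := by fun_prop
    have := (hc.tendsto yhat).mono_left (nhdsWithin_le_nhds (s := Ici yhat))
    simpa using this
  have hPeq : ∀ᶠ y in 𝓝[≥] yhat, P y = H √(y - yhat) := by
    filter_upwards [hsqrtc.eventually hPH, self_mem_nhdsWithin] with y hy hmem
    have h1 := hy (Real.sqrt_nonneg _)
    rwa [Real.sq_sqrt (sub_nonneg.2 hmem), add_sub_cancel] at h1
  have hpow : ∀ y, yhat ≤ y → ∀ n : ℕ, (y - yhat) ^ ((n : ℝ) / 2) = √(y - yhat) ^ n := by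
    intro y hy n
    rw [Real.sqrt_eq_rpow, ← Real.rpow_natCast, ← Real.rpow_mul (sub_nonneg.2 hy)]
    congr 1
    ring
  refine ⟨ha, by nlinarith [mul_pos (neg_pos.2 hγ) hω], hdisc, hdom, ⟨Q, ?_, ?_⟩,
    ⟨p.coeff, ?_, hc1, hc2, hc3, ?_⟩, ?_⟩
  · intro y hy
    obtain ⟨φ, hφ, h1, h2⟩ := hval y hy
    rw [h2, ← h1]
    exact (hQ φ hφ).1
  · rintro - ⟨y, hy, rfl⟩
    obtain ⟨φ, hφ, -, h2⟩ := hval y hy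
    rw [h2]
    exact (hQ φ hφ).2.1.analyticWithinAt
  · have := hp.coeff_zero 1
    rw [hH0] at this
    exact this
  · have hsum : ∀ᶠ y in 𝓝[≥] yhat, HasSum (fun n : ℕ => p.coeff n * (y - yhat) ^ ((n : ℝ) / 2))
        (P y) := by
      filter_upwards [hPeq, hsqrtc.eventually (hasFPowerSeriesAt_iff.1 hp), self_mem_nhdsWithin]
        with y h1 h2 hmem
      rw [zero_add] at h2
      rw [h1]
      refine h2.congr_fun fun n => ?_
      rw [hpow y hmem, smul_eq_mul, mul_comm]
    obtain ⟨u, hu, hsub⟩ := mem_nhdsGE_iff_exists_Ico_subset.1 hsum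
    refine ⟨u - yhat, sub_pos.2 hu, fun y hy => ?_⟩
    rw [add_sub_cancel] at hy
    exact hsub hy
  -- With `s = √(y - yhat)` the error is exactly `s ^ 4 * R s`, that is `(y - yhat) ^ 2` times a
  -- bounded factor.
  · have hbound : (fun y => R √(y - yhat)) =O[𝓝[≥] yhat] fun _ => (1 : ℝ) :=
      (hR.tendsto.comp hsqrtc).isBigO_one ℝ
    refine ((isBigO_refl (fun y : ℝ => (y - yhat) ^ 2) (𝓝[≥] yhat)).mul hbound).congr' ?_
      (by simp)
    filter_upwards [hPeq, self_mem_nhdsWithin] with y h1 hmem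
    have e1 := hpow y hmem 1
    have e3 := hpow y hmem 3
    have e2 := Real.sq_sqrt (sub_nonneg.2 hmem)
    rw [Nat.cast_one, pow_one] at e1
    rw [show ((3 : ℕ) : ℝ) = 3 by norm_num] at e3
    rw [e1, e3, h1, hHR, hc1, hc2, hc3, ← e2]
    simp only [Real.sqrt_sq (Real.sqrt_nonneg _)]
    ring
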